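/- Let $E$ be a Polish space with its Borel $\sigma$-algebra and let $\tilde d:E\times E\to[0,\infty)$ be measurable and symmetric, with $\tilde d(x,y)=0$ if and only if $x=y$ (for example $\tilde d(x,y)=\sqrt{d(x,y)(1+V(x)+V(y))}$ with $d$ symmetric, lower semicontinuous and zero exactly on the diagonal, and $V\ge 0$ measurable). For measures $\nu_1,\nu_2$ on $E$ put $$\tilde d(\nu_1,\nu_2)=\inf_{\pi\in\Gamma(\nu_1,\nu_2)}\int_{E\times E}\tilde d(x,y)\,\pi(dx,dy)\in[0,\infty],$$ where $\Gamma(\nu_1,\nu_2)$ is the set of measures on $E\times E$ with marginals $\nu_1$ and $\nu_2$. Let $\mathrm{Lip}(\tilde d)$ be the set of measurable $f:E\to\mathbb R$ for which there is $L<\infty$ with $|f(x)-f(y)|\le L\,\tilde d(x,y)$ for all $x,y\in E$. For a function $f\ge 0$, let $f\mu$ denote the measure with density $f$ with respect to $\mu$. Let $\mathcal P$ be a Markov kernel on $E$ which is reversible with respect to a probability measure $\mu$, write $(\mathcal P^n f)(x)=\int f(y)\,\mathcal P^n(x,dy)$ and $\mu(f)=\int f\,d\mu$, and suppose that $\mathrm{Lip}(\tilde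 d)\cap L^\infty_\mu$ is dense in $L^2_\mu$. Let $\lambda>0$, and suppose that for every $f\in\mathrm{Lip}(\tilde d)\cap L^\infty_\mu$ with $f\ge 0$ and $\mu(f)=1$ one has $\tilde d(f\mu,\mu)<\infty$ and there is a constant $C(f)<\infty$ such that $$\tilde d\big((\mathcal P^n f)\mu,\mu\big)\le C(f)\,e^{-\lambda n}\,\tilde d(f\mu,\mu)\qquad\text{for all } n\in\mathbb N.$$ Then for every $f\in L^2_\mu$ and every $n\in\mathbb N$ $$\|\mathcal P^n f-\mu(f)\|_2^2\le \|f-\mu(f)\|_2^2\,e^{-\lambda n}.$$ In particular $\mathcal P$ has an $L^2_\mu$-spectral gap, that is, $$\beta=\sup_{f\in L^2_\mu}\frac{\|\mathcal P f-\mu(f)\|_2}{\|f-\mu(f)\|_2}<1$$ (with the convention $0/0=0$). -/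

import Mathlib

open MeasureTheory ProbabilityTheory
open scoped NNReal ENNReal

noncomputable section

namespace WassersteinGap

/-- The cost functions `d̃ : E × E → [0, ∞)`: jointly measurable, symmetric and vanishing exactly on
the diagonal. Every lower semicontinuous distance-like function is of this kind, and so is
`d̃ (x, y) = √(d (x, y) (1 + V x + V y))` for such a `d` and a measurable `V ≥ 0`.
The triangle inequality is not required. -/
structure IsDistanceLike {E : Type*} [MeasurableSpace E] (d : E → E → ℝ≥0) : Prop where
  measurable : Measurable (Function.uncurry d)
  symm : ∀ x y, d x y = d y x
  eq_zero_iff : ∀ x y, d x y = 0 ↔ x = y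

/-- Couplings of `ν₁` and `ν₂`: measures on `E × E` with marginals `ν₁` and `ν₂`. -/
def couplings {E : Type*} [MeasurableSpace E] (ν₁ ν₂ : Measure E) : Set (Measure (E × E)) :=
  {π | π.map Prod.fst = ν₁ ∧ π.map Prod.snd = ν₂}

/-- The `1`-Wasserstein distance associated with `d`; it is `∞` if no coupling has finite cost. -/
def wasserstein {E : Type*} [MeasurableSpace E] (d : E → E → ℝ≥0) (ν₁ ν₂ : Measure E) : ℝ≥0∞ :=
  ⨅ π ∈ couplings ν₁ ν₂, ∫⁻ z, (d z.1 z.2 : ℝ≥0∞) ∂π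

/-- The action `(P f)(x) = ∫ f(y) P(x, dy)` of a kernel on functions. -/
def markovOp {E : Type*} [MeasurableSpace E] (P : Kernel E E) (f : E → ℝ) (x : E) : ℝ :=
  ∫ y, f y ∂(P x)

/-- The measure `f μ` with density `f ≥ 0` with respect to `μ`. -/
def densityMeasure {E : Type*} [MeasurableSpace E] (f : E → ℝ) (μ : Measure E) : Measure E :=
  μ.withDensity fun x => ENNReal.ofReal (f x)

/-- `f ∈ Lip(d) ∩ L^∞(μ)`. -/
structure IsLipBounded {E : Type*} [MeasurableSpace E] (d : E → E → ℝ≥0) (μ : Measure E)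
    (f : E → ℝ) : Prop where
  measurable : Measurable f
  lipschitz : ∃ L : ℝ≥0, ∀ x y, |f x - f y| ≤ L * d x y
  memLp_top : MemLp f ∞ μ

/-- `β = sup ‖P f - μ(f)‖₂ / ‖f - μ(f)‖₂` over `f ∈ L²(μ)`, the norm of `P` on the mean-zero part
of `L²(μ)` (with `0 / 0 = 0`). -/
def l2Beta {E : Type*} [MeasurableSpace E] (P : Kernel E E) (μ : Measure E) : ℝ≥0∞ :=
  ⨆ (f : E → ℝ) (_ : MemLp f 2 μ),
    eLpNorm (fun x => markovOp P f x - ∫ y, f y ∂μ) 2 μ / eLpNorm (fun x => f x - ∫ y, f y ∂μ) 2 μ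

/-- `P` has an `L²(μ)`-spectral gap (equal to `1 - β`). -/
def HasL2SpectralGap {E : Type*} [MeasurableSpace E] (P : Kernel E E) (μ : Measure E) : Prop :=
  l2Beta P μ < 1

end WassersteinGap

end

/-!
For a density `f`, Kantorovich duality bounds the autocorrelation `⟪f, Pⁿ f⟫ - μ(f)²`, which is the
difference of the integrals of `f` against `(Pⁿ f) μ` and `μ`, by `Lip(f) · d̃((Pⁿ f) μ, μ)`, hence
by a constant times `e^{-λ n}`. The constant depends on `f`, but by reversibility it can be removed:
for a symmetric operator `T` the sequence `aₙ = ‖Tⁿ x‖` satisfies `aₙ² = ⟪x, T²ⁿ x⟫ ≤ a₀ a₂ₙ`, and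
iterating along `n, 2n, 4n, …` shows that `aₙ ≤ K rⁿ` for some `K` forces `aₙ ≤ a₀ rⁿ`. As
`f - μ(f)` is, for every bounded Lipschitz `f`, a multiple of a centred density, this gives
`‖Pⁿ f - μ(f)‖₂ ≤ e^{-λ n} ‖f - μ(f)‖₂` on a dense subspace, and the bound passes to the closure.
-/

namespace WassersteinGap

section Sequences

lemma le_one_of_sq_le_apply_two_mul {b : ℕ → ℝ} {K : ℝ} (hsq : ∀ n, b n ^ 2 ≤ b (2 * n))
    (hK : ∀ n, b n ≤ K) (n : ℕ) : b n ≤ 1 := by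
  by_contra! hn
  have hpow (k : ℕ) : b n ^ 2 ^ k ≤ b (2 ^ k * n) := by
    induction k with
    | zero => simp
    | succ k ih =>
      calc b n ^ 2 ^ (k + 1) = (b n ^ 2 ^ k) ^ 2 := by rw [← pow_mul, pow_succ]
        _ ≤ b (2 ^ k * n) ^ 2 := by gcongr
        _ ≤ b (2 * (2 ^ k * n)) := hsq _
        _ = b (2 ^ (k + 1) * n) := by rw [pow_succ']; ring_nf
  obtain ⟨k, hk⟩ := pow_unbounded_of_one_lt K hn
  have hk2 : b n ^ k ≤ b n ^ 2 ^ k := pow_le_pow_right₀ hn.le Nat.lt_two_pow_self.le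
  linarith [hpow k, hK (2 ^ k * n)]

lemma le_mul_pow_of_sq_le_mul {a : ℕ → ℝ} {K r : ℝ} (ha : 0 ≤ a 0) (hr : 0 < r)
    (hsq : ∀ n, a n ^ 2 ≤ a 0 * a (2 * n)) (hK : ∀ n, a n ≤ K * r ^ n) (n : ℕ) :
    a n ≤ a 0 * r ^ n := by
  rcases ha.eq_or_lt with h0 | h0
  · have hn : a n ^ 2 = 0 := le_antisymm (by simpa [← h0] using hsq n) (sq_nonneg _)
    simp [← h0, pow_eq_zero_iff two_ne_zero |>.1 hn]
  · have hb : a n / (a 0 * r ^ n) ≤ 1 := by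
      refine le_one_of_sq_le_apply_two_mul (b := fun n => a n / (a 0 * r ^ n)) (K := K / a 0)
        (fun n => ?_) (fun n => ?_) n
      · rw [div_pow, div_le_div_iff₀ (by positivity) (by positivity)]
        calc a n ^ 2 * (a 0 * r ^ (2 * n)) ≤ a 0 * a (2 * n) * (a 0 * r ^ (2 * n)) := by
              gcongr; exact hsq n
          _ = a (2 * n) * (a 0 * r ^ n) ^ 2 := by ring
      · rw [div_le_div_iff₀ (by positivity) h0]
        calc a n * a 0 ≤ K * r ^ n * a 0 := by gcongr; exact hK n
          _ = K * (a 0 * r ^ n) := by ring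
    exact (div_le_one (by positivity)).1 hb

end Sequences

section Symmetric

variable {𝕜 H : Type*} [RCLike 𝕜] [NormedAddCommGroup H] [InnerProductSpace 𝕜 H]
  {T J : H →ₗ[𝕜] H}

lemma norm_pow_apply_sq (hT : T.IsSymmetric) (n : ℕ) (x : H) :
    ‖(T ^ n) x‖ ^ 2 = RCLike.re (inner 𝕜 x ((T ^ (2 * n)) x)) := by
  rw [two_mul, pow_add, Module.End.mul_apply, ← hT.pow n, inner_self_eq_norm_sq]

lemma norm_pow_apply_le_of_inner_le (hT : T.IsSymmetric) {x : H} {K r : ℝ} (hr : 0 < r)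
    (hK : ∀ n, RCLike.re (inner 𝕜 x ((T ^ n) x)) ≤ K * r ^ n) (n : ℕ) :
    ‖(T ^ n) x‖ ≤ ‖x‖ * r ^ n := by
  refine le_mul_pow_of_sq_le_mul (a := fun n => ‖(T ^ n) x‖) (K := √K) (norm_nonneg _) hr
    (fun n => ?_) (fun n => ?_) n
  · rw [norm_pow_apply_sq hT]
    exact re_inner_le_norm x _
  · calc ‖(T ^ n) x‖ = √(‖(T ^ n) x‖ ^ 2) := (Real.sqrt_sq (norm_nonneg _)).symm
      _ ≤ √(K * (r ^ n) ^ 2) := by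
          rw [norm_pow_apply_sq hT, ← pow_mul, mul_comm n]
          exact Real.sqrt_le_sqrt (hK _)
      _ = √K * r ^ n := by
          rw [Real.sqrt_mul' _ (sq_nonneg _), Real.sqrt_sq (by positivity)]

lemma inner_sub_apply_sub (hT : T.IsSymmetric) (hJ : J.IsSymmetric) (hJJ : ∀ x, J (J x) = J x)
    (hTJ : ∀ x, T (J x) = J x) (x : H) :
    inner 𝕜 (x - J x) (T (x - J x)) = inner 𝕜 x (T x) - inner 𝕜 x (J x) := by
  have h1 : inner 𝕜 (J x) (T x) = inner 𝕜 x (J x) := by rw [← hT, hTJ, hJ]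
  have h2 : inner 𝕜 (J x) (J x) = inner 𝕜 x (J x) := by rw [hJ, hJJ]
  rw [map_sub, hTJ, inner_sub_left, inner_sub_right, inner_sub_right, h1, h2, sub_self, sub_zero]

end Symmetric

section MarkovOp

variable {E : Type*} [MeasurableSpace E] {P κ η : Kernel E E} {μ : Measure E} {f g : E → ℝ}

lemma markovOp_congr_ae (h : P.Invariant μ) (hfg : f =ᵐ[μ] g) :
    markovOp P f =ᵐ[μ] markovOp P g := by
  filter_upwards [Measure.ae_ae_of_ae_comp (κ := P) (by rwa [h.def])] with x hx
  exact integral_congr_ae hx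

lemma integrable_markovOp (h : P.Invariant μ) (hf : Integrable f μ) :
    Integrable (markovOp P f) μ := by
  have hf' : Integrable f ((P ∘ₖ Kernel.const Unit μ) ()) := by
    rwa [← Measure.comp_eq_comp_const_apply, h.def]
  exact hf'.integral_comp

lemma markovOp_comp_ae_eq (h : (η ∘ₖ κ).Invariant μ) (hf : Integrable f μ) :
    markovOp (η ∘ₖ κ) f =ᵐ[μ] markovOp κ (markovOp η f) := by
  filter_upwards [Measure.ae_integrable_of_integrable_comp (κ := η ∘ₖ κ) (by rwa [h.def])] with x hx
  exact Kernel.integral_comp hx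

instance isMarkovKernel_pow [IsMarkovKernel P] (n : ℕ) : IsMarkovKernel (P ^ n) := by
  induction n with
  | zero => exact inferInstanceAs (IsMarkovKernel Kernel.id)
  | succ n ih => exact inferInstanceAs (IsMarkovKernel ((P ^ n) ∘ₖ P))

lemma invariant_id : (Kernel.id : Kernel E E).Invariant μ := Measure.bind_dirac

lemma invariant_pow (h : P.Invariant μ) (n : ℕ) : (P ^ n).Invariant μ := by
  induction n with
  | zero => exact invariant_id
  | succ n ih => exact ih.comp h

lemma isReversible_const : (Kernel.const E μ).IsReversible μ := fun A B _ _ => by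
  simp [mul_comm]

end MarkovOp

section TwoStep

variable {E : Type*} [MeasurableSpace E] {P : Kernel E E} [IsMarkovKernel P] {μ : Measure E}

lemma measurePreserving_fst_compProd [SFinite μ] : MeasurePreserving Prod.fst (μ ⊗ₘ P) μ :=
  ⟨measurable_fst, Measure.fst_compProd μ P⟩

lemma measurePreserving_snd_compProd [SFinite μ] (h : P.Invariant μ) :
    MeasurePreserving Prod.snd (μ ⊗ₘ P) μ :=
  ⟨measurable_snd, (Measure.snd_compProd μ P).trans h.def⟩

lemma measurePreserving_swap_compProd [IsFiniteMeasure μ] (h : P.IsReversible μ) :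
    MeasurePreserving Prod.swap (μ ⊗ₘ P) (μ ⊗ₘ P) := by
  refine ⟨measurable_swap, ?_⟩
  have : IsFiniteMeasure ((μ ⊗ₘ P).map Prod.swap) := Measure.isFiniteMeasure_map _ _
  refine Measure.ext_prod fun {s t} hs ht => ?_
  rw [Measure.map_apply measurable_swap (hs.prod ht), Set.preimage_swap_prod,
    Measure.compProd_apply_prod ht hs, Measure.compProd_apply_prod hs ht]
  exact h ht hs

end TwoStep

section L2Op

variable {E : Type*} [MeasurableSpace E] {P κ η : Kernel E E} {μ : Measure E}
  [IsMarkovKernel P] [IsMarkovKernel κ] [IsMarkovKernel η]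

/-- The action of a Markov kernel with invariant measure `μ` as an operator on `L²(μ)`. It is
defined by `⟪f, P g⟫ = E[f(X₀) g(X₁)]`, where `(X₀, X₁)` has law `μ ⊗ₘ P`; it agrees with
`markovOp P` almost everywhere, see `l2Op_ae_eq`. -/
noncomputable def l2Op [SFinite μ] (h : P.Invariant μ) : Lp ℝ 2 μ →L[ℝ] Lp ℝ 2 μ :=
  ContinuousLinearMap.adjoint
      (Lp.compMeasurePreservingₗᵢ ℝ Prod.fst
        (measurePreserving_fst_compProd (P := P))).toContinuousLinearMap ∘L
    (Lp.compMeasurePreservingₗᵢ ℝ Prod.snd (measurePreserving_snd_compProd h)).toContinuousLinearMap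

lemma inner_l2Op [SFinite μ] (h : P.Invariant μ) (f g : Lp ℝ 2 μ) :
    inner ℝ f (l2Op h g) =
      inner ℝ (Lp.compMeasurePreserving Prod.fst (measurePreserving_fst_compProd (P := P)) f)
        (Lp.compMeasurePreserving Prod.snd (measurePreserving_snd_compProd h) g) := by
  rw [l2Op, ContinuousLinearMap.comp_apply, ContinuousLinearMap.adjoint_inner_right]
  rfl

lemma l2Op_isSymmetric [IsFiniteMeasure μ] (h : P.IsReversible μ) :
    (l2Op h.invariant : Lp ℝ 2 μ →ₗ[ℝ] Lp ℝ 2 μ).IsSymmetric := by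
  intro f g
  let swapₗᵢ := Lp.compMeasurePreservingₗᵢ ℝ (E := ℝ) (p := 2) Prod.swap
    (measurePreserving_swap_compProd h)
  have hfst :
      swapₗᵢ (Lp.compMeasurePreserving Prod.fst (measurePreserving_fst_compProd (P := P)) g) =
        Lp.compMeasurePreserving Prod.snd (measurePreserving_snd_compProd h.invariant) g :=
    (Lp.compMeasurePreserving_comp_apply ..).symm
  have hsnd :
      swapₗᵢ (Lp.compMeasurePreserving Prod.snd (measurePreserving_snd_compProd h.invariant) f) =
        Lp.compMeasurePreserving Prod.fst (measurePreserving_fst_compProd (P := P)) f :=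
    (Lp.compMeasurePreserving_comp_apply ..).symm
  simp only [ContinuousLinearMap.coe_coe]
  rw [real_inner_comm, inner_l2Op, inner_l2Op, real_inner_comm, ← hfst, ← hsnd,
    swapₗᵢ.inner_map_map]

lemma l2Op_ae_eq [IsFiniteMeasure μ] (h : P.Invariant μ) (g : Lp ℝ 2 μ) :
    l2Op h g =ᵐ[μ] markovOp P g := by
  have hg : Integrable g μ := (Lp.memLp g).integrable one_le_two
  refine Integrable.ae_eq_of_forall_setIntegral_eq _ _
    ((Lp.memLp _).integrable one_le_two) (integrable_markovOp h hg) fun s hs _ => ?_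
  have hsnd := Lp.coeFn_compMeasurePreserving g (measurePreserving_snd_compProd h)
  have hint : Integrable (fun z => g z.2) (μ ⊗ₘ P) :=
    (measurePreserving_snd_compProd h).integrable_comp_of_integrable hg
  calc ∫ x in s, l2Op h g x ∂μ
      = ∫ z in Prod.fst ⁻¹' s,
          Lp.compMeasurePreserving Prod.snd (measurePreserving_snd_compProd h) g z ∂(μ ⊗ₘ P) := by
        rw [← L2.inner_indicatorConstLp_one hs (measure_ne_top μ s), inner_l2Op,
          Lp.indicatorConstLp_compMeasurePreserving, L2.inner_indicatorConstLp_one]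
    _ = ∫ z in s ×ˢ Set.univ, g z.2 ∂(μ ⊗ₘ P) := by
        rw [Set.prod_univ]
        exact integral_congr_ae (ae_restrict_of_ae hsnd)
    _ = ∫ x in s, markovOp P g x ∂μ := by
        rw [Measure.setIntegral_compProd hs .univ hint.integrableOn]
        simp only [Measure.restrict_univ, markovOp]

lemma l2Op_comp_apply [IsFiniteMeasure μ] (hκ : κ.Invariant μ) (hη : η.Invariant μ)
    (hP : P.Invariant μ) (h : η ∘ₖ κ = P) (g : Lp ℝ 2 μ) : l2Op hP g = l2Op hκ (l2Op hη g) := by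
  subst h
  refine Lp.ext ?_
  calc l2Op hP g =ᵐ[μ] markovOp (η ∘ₖ κ) g := l2Op_ae_eq hP g
    _ =ᵐ[μ] markovOp κ (markovOp η g) :=
        markovOp_comp_ae_eq hP ((Lp.memLp g).integrable one_le_two)
    _ =ᵐ[μ] markovOp κ (l2Op hη g) := markovOp_congr_ae hκ (l2Op_ae_eq hη g).symm
    _ =ᵐ[μ] l2Op hκ (l2Op hη g) := (l2Op_ae_eq hκ _).symm

lemma l2Op_id_apply [IsFiniteMeasure μ] (g : Lp ℝ 2 μ) : l2Op (invariant_id (μ := μ)) g = g := by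
  refine Lp.ext ((l2Op_ae_eq _ g).trans (.of_forall fun x => ?_))
  rw [markovOp, Kernel.id_apply, integral_dirac' _ _ (Lp.stronglyMeasurable g)]

lemma l2Op_pow_apply [IsFiniteMeasure μ] (h : P.Invariant μ) (n : ℕ) (g : Lp ℝ 2 μ) :
    l2Op (invariant_pow h n) g = ((l2Op h : Lp ℝ 2 μ →ₗ[ℝ] Lp ℝ 2 μ) ^ n) g := by
  induction n with
  | zero => exact l2Op_id_apply g
  | succ n ih =>
    calc l2Op (invariant_pow h (n + 1)) g = l2Op h (l2Op (invariant_pow h n) g) :=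
          l2Op_comp_apply h _ _ (pow_succ P n).symm g
      _ = _ := by rw [ih, pow_succ']; rfl

end L2Op

section Mean

variable {E : Type*} [MeasurableSpace E] {P : Kernel E E} [IsMarkovKernel P] {μ : Measure E}
  [IsProbabilityMeasure μ]

variable (μ) in
/-- The projection `f ↦ μ(f)` of `L²(μ)` onto the constants, seen as the operator of the kernel
which forgets its starting point. -/
noncomputable def meanOp : Lp ℝ 2 μ →L[ℝ] Lp ℝ 2 μ :=
  l2Op (isReversible_const (μ := μ)).invariant

lemma meanOp_ae_eq (g : Lp ℝ 2 μ) : meanOp μ g =ᵐ[μ] fun _ => ∫ x, g x ∂μ :=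
  l2Op_ae_eq _ g

lemma meanOp_isSymmetric : (meanOp μ : Lp ℝ 2 μ →ₗ[ℝ] Lp ℝ 2 μ).IsSymmetric :=
  l2Op_isSymmetric isReversible_const

lemma l2Op_meanOp (h : P.Invariant μ) (g : Lp ℝ 2 μ) : l2Op h (meanOp μ g) = meanOp μ g :=
  (l2Op_comp_apply h _ _ (Kernel.const_comp' μ P) g).symm

lemma meanOp_meanOp (g : Lp ℝ 2 μ) : meanOp μ (meanOp μ g) = meanOp μ g :=
  l2Op_meanOp _ g

lemma toLp_sub_meanOp_ae_eq {f : E → ℝ} (hf : MemLp f 2 μ) :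
    hf.toLp f - meanOp μ (hf.toLp f) =ᵐ[μ] fun x => f x - ∫ y, f y ∂μ := by
  filter_upwards [Lp.coeFn_sub (hf.toLp f) (meanOp μ (hf.toLp f)), hf.coeFn_toLp,
    meanOp_ae_eq (hf.toLp f)] with x hsub hfx hmean
  rw [hsub, Pi.sub_apply, hfx, hmean, integral_congr_ae hf.coeFn_toLp]

lemma l2Op_toLp_sub_meanOp_ae_eq (h : P.Invariant μ) {f : E → ℝ} (hf : MemLp f 2 μ) :
    l2Op h (hf.toLp f - meanOp μ (hf.toLp f)) =ᵐ[μ] fun x => markovOp P f x - ∫ y, f y ∂μ := by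
  rw [map_sub, l2Op_meanOp]
  filter_upwards [Lp.coeFn_sub (l2Op h (hf.toLp f)) (meanOp μ (hf.toLp f)),
    l2Op_ae_eq h (hf.toLp f), markovOp_congr_ae h hf.coeFn_toLp, meanOp_ae_eq (hf.toLp f)]
    with x hsub hop hcongr hmean
  rw [hsub, Pi.sub_apply, hop, hcongr, hmean, integral_congr_ae hf.coeFn_toLp]

end Mean

section Duality

variable {E : Type*} [MeasurableSpace E] {d : E → E → ℝ≥0} {f u : E → ℝ} {L : ℝ≥0}

lemma ofReal_integral_sub_le_wasserstein (hL0 : L ≠ 0) (hL : ∀ x y, |f x - f y| ≤ L * d x y)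
    {ν₁ ν₂ : Measure E} (h₁ : Integrable f ν₁) (h₂ : Integrable f ν₂) :
    ENNReal.ofReal (∫ x, f x ∂ν₁ - ∫ x, f x ∂ν₂) ≤ L * wasserstein d ν₁ ν₂ := by
  simp_rw [wasserstein, ENNReal.mul_iInf_of_ne (ENNReal.coe_ne_zero.2 hL0) ENNReal.coe_ne_top]
  refine le_iInf₂ ?_
  rintro π ⟨rfl, rfl⟩
  have hcost (z : E × E) : ‖f z.1 - f z.2‖ₑ ≤ L * d z.1 z.2 := by
    rw [Real.enorm_eq_ofReal_abs, ← ENNReal.coe_mul, ← ENNReal.ofReal_coe_nnreal, NNReal.coe_mul]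
    exact ENNReal.ofReal_le_ofReal (hL _ _)
  have hsub : ∫ z, (f z.1 - f z.2) ∂π = ∫ z, f z.1 ∂π - ∫ z, f z.2 ∂π :=
    integral_sub (h₁.comp_measurable measurable_fst) (h₂.comp_measurable measurable_snd)
  calc ENNReal.ofReal (∫ x, f x ∂π.map Prod.fst - ∫ x, f x ∂π.map Prod.snd)
      = ENNReal.ofReal (∫ z, (f z.1 - f z.2) ∂π) := by
        rw [integral_map measurable_fst.aemeasurable h₁.1,
          integral_map measurable_snd.aemeasurable h₂.1, hsub]
    _ ≤ ‖∫ z, (f z.1 - f z.2) ∂π‖ₑ := by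
        rw [Real.enorm_eq_ofReal_abs]
        exact ENNReal.ofReal_le_ofReal (le_abs_self _)
    _ ≤ ∫⁻ z, ‖f z.1 - f z.2‖ₑ ∂π := enorm_integral_le_lintegral_enorm _
    _ ≤ ∫⁻ z, L * d z.1 z.2 ∂π := lintegral_mono hcost
    _ = L * ∫⁻ z, d z.1 z.2 ∂π := lintegral_const_mul' _ _ ENNReal.coe_ne_top

variable {μ : Measure E}

lemma integrable_densityMeasure_iff (hu : AEMeasurable u μ) (hu0 : ∀ x, 0 ≤ u x) :
    Integrable f (densityMeasure u μ) ↔ Integrable (fun x => u x * f x) μ := by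
  rw [densityMeasure, integrable_withDensity_iff_integrable_smul₀' hu.ennreal_ofReal
    (.of_forall fun _ => ENNReal.ofReal_lt_top)]
  simp only [ENNReal.toReal_ofReal (hu0 _), smul_eq_mul]

lemma integral_densityMeasure (hu : AEMeasurable u μ) (hu0 : ∀ x, 0 ≤ u x) :
    ∫ x, f x ∂densityMeasure u μ = ∫ x, u x * f x ∂μ := by
  rw [densityMeasure, integral_withDensity_eq_integral_toReal_smul₀ hu.ennreal_ofReal
    (.of_forall fun _ => ENNReal.ofReal_lt_top)]
  simp only [ENNReal.toReal_ofReal (hu0 _), smul_eq_mul]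

lemma ofReal_integral_mul_sub_le_wasserstein (hL0 : L ≠ 0)
    (hL : ∀ x y, |f x - f y| ≤ L * d x y) (hf : Integrable f μ) (hu : AEMeasurable u μ)
    (hu0 : ∀ x, 0 ≤ u x) (huf : Integrable (fun x => u x * f x) μ) :
    ENNReal.ofReal (∫ x, u x * f x ∂μ - ∫ x, f x ∂μ) ≤
      L * wasserstein d (densityMeasure u μ) μ := by
  rw [← integral_densityMeasure hu hu0]
  exact ofReal_integral_sub_le_wasserstein hL0 hL ((integrable_densityMeasure_iff hu hu0).2 huf) hf

end Duality

section LipBounded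

variable {E : Type*} [MeasurableSpace E] {d : E → E → ℝ≥0} {μ : Measure E} {f : E → ℝ}

lemma IsLipBounded.exists_lipschitz_ne_zero (hf : IsLipBounded d μ f) :
    ∃ L : ℝ≥0, L ≠ 0 ∧ ∀ x y, |f x - f y| ≤ L * d x y := by
  obtain ⟨L, hL⟩ := hf.lipschitz
  refine ⟨L + 1, by positivity, fun x y => (hL x y).trans ?_⟩
  push_cast
  gcongr
  exact le_add_of_nonneg_right zero_le_one

lemma IsLipBounded.memLp_two [IsFiniteMeasure μ] (hf : IsLipBounded d μ f) : MemLp f 2 μ :=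
  hf.memLp_top.mono_exponent le_top

lemma IsLipBounded.comp_lipschitz (hf : IsLipBounded d μ f) {φ : ℝ → ℝ} {K : ℝ≥0}
    (hφ : LipschitzWith K φ) : IsLipBounded d μ (φ ∘ f) where
  measurable := hφ.continuous.measurable.comp hf.measurable
  lipschitz := by
    obtain ⟨L, hL⟩ := hf.lipschitz
    refine ⟨K * L, fun x y => ?_⟩
    calc |φ (f x) - φ (f y)| ≤ K * |f x - f y| := hφ.dist_le_mul _ _
      _ ≤ K * (L * d x y) := by gcongr; exact hL x y
      _ = ↑(K * L) * d x y := by push_cast; ring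
  memLp_top := by
    have hφ0 : LipschitzWith K fun t => φ t - φ 0 := by simpa using hφ.sub (.const (φ 0))
    convert (hφ0.comp_memLp (sub_self _) hf.memLp_top).add (memLp_top_const (φ 0)) using 1
    ext x
    simp

lemma IsLipBounded.exists_density [IsProbabilityMeasure μ] (hf : IsLipBounded d μ f) :
    ∃ (u : E → ℝ) (m : ℝ), IsLipBounded d μ u ∧ (∀ x, 0 ≤ u x) ∧ ∫ x, u x ∂μ = 1 ∧
      (fun x => f x - ∫ y, f y ∂μ) =ᵐ[μ] fun x => m * (u x - 1) := by
  obtain ⟨M, hM⟩ : ∃ M, ∀ᵐ x ∂μ, |f x| ≤ M :=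
    ⟨_, by simpa using ae_le_lpNorm_exponent_top hf.memLp_top⟩
  have hint : Integrable f μ := hf.memLp_two.integrable one_le_two
  -- `f ≥ -M` holds only almost everywhere, so `f` is cut off at `-M` before it is shifted.
  set m : ℝ := ∫ x, f x ∂μ + (M + 1) with hm
  have hm0 : 0 < m := by
    have : -M ≤ ∫ x, f x ∂μ := by
      simpa using integral_mono_ae (integrable_const (-M)) hint
        (hM.mono fun x hx => (abs_le.1 hx).1)
    linarith
  have hφ : LipschitzWith (‖m⁻¹‖₊ * (1 + 0)) fun t : ℝ => m⁻¹ * (max t (-M) + (M + 1)) :=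
    (lipschitzWith_smul m⁻¹).comp ((LipschitzWith.id.max_const (-M)).add (.const (M + 1)))
  have hae : ∀ᵐ x ∂μ, m⁻¹ * (max (f x) (-M) + (M + 1)) = m⁻¹ * (f x + (M + 1)) :=
    hM.mono fun x hx => by rw [max_eq_left (abs_le.1 hx).1]
  refine ⟨_, m, hf.comp_lipschitz hφ, fun x => ?_, ?_, ?_⟩
  · have := le_max_right (f x) (-M)
    exact mul_nonneg (by positivity) (by linarith)
  · calc ∫ x, m⁻¹ * (max (f x) (-M) + (M + 1)) ∂μ = ∫ x, m⁻¹ * (f x + (M + 1)) ∂μ :=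
          integral_congr_ae hae
      _ = 1 := by
          rw [integral_const_mul, integral_add hint (integrable_const _)]
          simp [← hm, hm0.ne']
  · filter_upwards [hae] with x hx
    calc f x - ∫ y, f y ∂μ = m * (m⁻¹ * (f x + (M + 1)) - 1) := by
          rw [mul_sub, mul_inv_cancel_left₀ hm0.ne', hm]
          ring
      _ = _ := by rw [← hx]; rfl

end LipBounded

section Decay

variable {E : Type*} [MeasurableSpace E] {d : E → E → ℝ≥0} {P : Kernel E E} {μ : Measure E}
  {lam : ℝ} {f : E → ℝ}

/-- Exponential convergence to equilibrium at rate `lam`, in the Wasserstein distance of `d`, from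
every initial law with density in `Lip(d) ∩ L^∞(μ)`. The prefactor `C` may depend on the density. -/
def WassersteinDecay (d : E → E → ℝ≥0) (P : Kernel E E) (μ : Measure E) (lam : ℝ) : Prop :=
  ∀ f : E → ℝ, IsLipBounded d μ f → (∀ x, 0 ≤ f x) → ∫ x, f x ∂μ = 1 →
    wasserstein d (densityMeasure f μ) μ < ∞ ∧
    ∃ C : ℝ≥0, ∀ n : ℕ, wasserstein d (densityMeasure (markovOp (P ^ n) f) μ) μ ≤
      C * ENNReal.ofReal (Real.exp (-lam * n)) * wasserstein d (densityMeasure f μ) μ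

variable [IsMarkovKernel P] [IsProbabilityMeasure μ]

lemma inner_toLp_l2Op (h : P.Invariant μ) (hf : MemLp f 2 μ) :
    inner ℝ (hf.toLp f) (l2Op h (hf.toLp f)) = ∫ x, markovOp P f x * f x ∂μ := by
  rw [L2.inner_def]
  refine integral_congr_ae ?_
  filter_upwards [hf.coeFn_toLp, l2Op_ae_eq h (hf.toLp f), markovOp_congr_ae h hf.coeFn_toLp]
    with x hfx hop hcongr
  rw [hop, hcongr, hfx]
  rfl

lemma inner_toLp_meanOp (hf : MemLp f 2 μ) :
    inner ℝ (hf.toLp f) (meanOp μ (hf.toLp f)) = (∫ x, f x ∂μ) ^ 2 := by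
  rw [meanOp, inner_toLp_l2Op, sq, ← integral_const_mul]
  rfl

lemma integrable_markovOp_mul (h : P.Invariant μ) (hf : MemLp f 2 μ) :
    Integrable (fun x => markovOp P f x * f x) μ := by
  have hPf : MemLp (markovOp P f) 2 μ := (memLp_congr_ae
    ((l2Op_ae_eq h (hf.toLp f)).trans (markovOp_congr_ae h hf.coeFn_toLp))).1 (Lp.memLp _)
  exact hPf.integrable_mul hf

lemma WassersteinDecay.exists_autocorrelation_le (hP : P.Invariant μ)
    (h : WassersteinDecay d P μ lam) (hf : IsLipBounded d μ f) (hf0 : ∀ x, 0 ≤ f x)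
    (hf1 : ∫ x, f x ∂μ = 1) :
    ∃ K : ℝ, ∀ n : ℕ, ∫ x, markovOp (P ^ n) f x * f x ∂μ - 1 ≤ K * Real.exp (-lam) ^ n := by
  obtain ⟨hW, C, hC⟩ := h f hf hf0 hf1
  obtain ⟨L, hL0, hL⟩ := hf.exists_lipschitz_ne_zero
  set W := wasserstein d (densityMeasure f μ) μ
  have hint : Integrable f μ := hf.memLp_two.integrable one_le_two
  refine ⟨L * (C * W.toReal), fun n => ?_⟩
  have hPn := invariant_pow hP n
  have hdual : ENNReal.ofReal (∫ x, markovOp (P ^ n) f x * f x ∂μ - 1) ≤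
      L * (C * ENNReal.ofReal (Real.exp (-lam * n)) * W) := by
    rw [← hf1]
    refine (ofReal_integral_mul_sub_le_wasserstein hL0 hL hint
      (integrable_markovOp hPn hint).aemeasurable (fun x => integral_nonneg hf0)
      (integrable_markovOp_mul hPn hf.memLp_two)).trans ?_
    gcongr
    exact hC n
  calc ∫ x, markovOp (P ^ n) f x * f x ∂μ - 1
      ≤ (L * (C * ENNReal.ofReal (Real.exp (-lam * n)) * W)).toReal :=
        (ENNReal.ofReal_le_iff_le_toReal (by finiteness)).1 hdual
    _ = L * (C * Real.exp (-lam * n) * W.toReal) := by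
        simp only [ENNReal.toReal_mul, ENNReal.coe_toReal,
          ENNReal.toReal_ofReal (Real.exp_pos _).le]
    _ = L * (C * W.toReal) * Real.exp (-lam) ^ n := by
        rw [← Real.exp_nat_mul, mul_comm (n : ℝ)]
        ring

lemma WassersteinDecay.norm_l2Op_pow_le_of_density (hrev : P.IsReversible μ)
    (h : WassersteinDecay d P μ lam) (hf : IsLipBounded d μ f) (hf0 : ∀ x, 0 ≤ f x)
    (hf1 : ∫ x, f x ∂μ = 1) (n : ℕ) :
    ‖l2Op (invariant_pow hrev.invariant n)
        (hf.memLp_two.toLp f - meanOp μ (hf.memLp_two.toLp f))‖ ≤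
      ‖hf.memLp_two.toLp f - meanOp μ (hf.memLp_two.toLp f)‖ * Real.exp (-lam) ^ n := by
  obtain ⟨K, hK⟩ := h.exists_autocorrelation_le hrev.invariant hf hf0 hf1
  rw [l2Op_pow_apply]
  refine norm_pow_apply_le_of_inner_le (K := K) (l2Op_isSymmetric hrev) (Real.exp_pos _)
    (fun n => ?_) n
  have hinner := inner_sub_apply_sub ((l2Op_isSymmetric hrev).pow n) meanOp_isSymmetric
    (meanOp_meanOp (μ := μ)) (fun g => by
      simp only [ContinuousLinearMap.coe_coe, ← l2Op_pow_apply, l2Op_meanOp])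
    (hf.memLp_two.toLp f)
  simp only [ContinuousLinearMap.coe_coe] at hinner
  rw [hinner, ← l2Op_pow_apply, inner_toLp_l2Op, inner_toLp_meanOp, hf1, one_pow]
  exact hK n

lemma WassersteinDecay.norm_l2Op_pow_le_of_isLipBounded (hrev : P.IsReversible μ)
    (h : WassersteinDecay d P μ lam) (hf : IsLipBounded d μ f) (n : ℕ) :
    ‖l2Op (invariant_pow hrev.invariant n)
        (hf.memLp_two.toLp f - meanOp μ (hf.memLp_two.toLp f))‖ ≤
      ‖hf.memLp_two.toLp f - meanOp μ (hf.memLp_two.toLp f)‖ * Real.exp (-lam) ^ n := by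
  obtain ⟨u, m, hu, hu0, hu1, hfu⟩ := hf.exists_density
  have hsmul : hf.memLp_two.toLp f - meanOp μ (hf.memLp_two.toLp f) =
      m • (hu.memLp_two.toLp u - meanOp μ (hu.memLp_two.toLp u)) := by
    refine Lp.ext ?_
    filter_upwards [toLp_sub_meanOp_ae_eq hf.memLp_two, toLp_sub_meanOp_ae_eq hu.memLp_two, hfu,
      Lp.coeFn_smul m (hu.memLp_two.toLp u - meanOp μ (hu.memLp_two.toLp u))] with x h1 h2 h3 h4
    rw [h1, h3, h4, Pi.smul_apply, h2, hu1, smul_eq_mul]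
  rw [hsmul, map_smul, norm_smul, norm_smul, mul_assoc]
  gcongr
  exact h.norm_l2Op_pow_le_of_density hrev hu hu0 hu1 n

lemma WassersteinDecay.norm_l2Op_pow_le (hrev : P.IsReversible μ) (h : WassersteinDecay d P μ lam)
    (hdense : Dense {g : Lp ℝ 2 μ | ∃ f : E → ℝ, IsLipBounded d μ f ∧ g =ᵐ[μ] f})
    (n : ℕ) (g : Lp ℝ 2 μ) :
    ‖l2Op (invariant_pow hrev.invariant n) (g - meanOp μ g)‖ ≤
      ‖g - meanOp μ g‖ * Real.exp (-lam) ^ n := by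
  refine hdense.induction ?_ (isClosed_le (by fun_prop) (by fun_prop)) g
  rintro g ⟨f, hf, hgf⟩
  obtain rfl : hf.memLp_two.toLp f = g := Lp.ext (hf.memLp_two.coeFn_toLp.trans hgf.symm)
  exact h.norm_l2Op_pow_le_of_isLipBounded hrev hf n

lemma WassersteinDecay.eLpNorm_markovOp_pow_le (hrev : P.IsReversible μ)
    (h : WassersteinDecay d P μ lam)
    (hdense : Dense {g : Lp ℝ 2 μ | ∃ f : E → ℝ, IsLipBounded d μ f ∧ g =ᵐ[μ] f})
    (hf : MemLp f 2 μ) (n : ℕ) :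
    eLpNorm (fun x => markovOp (P ^ n) f x - ∫ y, f y ∂μ) 2 μ ≤
      eLpNorm (fun x => f x - ∫ y, f y ∂μ) 2 μ * ENNReal.ofReal (Real.exp (-lam * n)) := by
  have hexp : Real.exp (-lam) ^ n = Real.exp (-lam * n) := by
    rw [← Real.exp_nat_mul, mul_comm]
  rw [← eLpNorm_congr_ae (l2Op_toLp_sub_meanOp_ae_eq (invariant_pow hrev.invariant n) hf),
    ← eLpNorm_congr_ae (toLp_sub_meanOp_ae_eq hf), ← Lp.enorm_def, ← Lp.enorm_def, ← ofReal_norm,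
    ← ofReal_norm, ← ENNReal.ofReal_mul (norm_nonneg _), ← hexp]
  exact ENNReal.ofReal_le_ofReal (h.norm_l2Op_pow_le hrev hdense n _)

end Decay

lemma l2Beta_le {E : Type*} [MeasurableSpace E] {P : Kernel E E} {μ : Measure E} {c : ℝ≥0∞}
    (h : ∀ f : E → ℝ, MemLp f 2 μ → eLpNorm (fun x => markovOp P f x - ∫ y, f y ∂μ) 2 μ ≤
      eLpNorm (fun x => f x - ∫ y, f y ∂μ) 2 μ * c) : l2Beta P μ ≤ c :=
  iSup₂_le fun f hf => ENNReal.div_le_of_le_mul' (h f hf)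

lemma sq_le_sq_mul_of_le_mul {a b c : ℝ≥0∞} (h : a ≤ b * c) (hc : c ≤ 1) : a ^ 2 ≤ b ^ 2 * c :=
  calc a ^ 2 ≤ (b * c) ^ 2 := by gcongr
    _ = b ^ 2 * (c * c) := by ring
    _ ≤ b ^ 2 * c := by
        gcongr
        exact mul_le_of_le_one_right' hc

end WassersteinGap

theorem proposition2p2_general {E : Type*} [MeasurableSpace E] {d : E → E → ℝ≥0}
    {P : Kernel E E} [IsMarkovKernel P] {μ : Measure E} [IsProbabilityMeasure μ]
    (hrev : P.IsReversible μ)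
    (hdense : Dense {g : Lp ℝ 2 μ | ∃ f : E → ℝ, WassersteinGap.IsLipBounded d μ f ∧ g =ᵐ[μ] f})
    {lam : ℝ} (hdecay : WassersteinGap.WassersteinDecay d P μ lam) :
    (∀ f : E → ℝ, MemLp f 2 μ → ∀ n : ℕ,
      eLpNorm (fun x => WassersteinGap.markovOp (P ^ n) f x - ∫ y, f y ∂μ) 2 μ ≤
        eLpNorm (fun x => f x - ∫ y, f y ∂μ) 2 μ * ENNReal.ofReal (Real.exp (-lam * n))) ∧
    WassersteinGap.l2Beta P μ ≤ ENNReal.ofReal (Real.exp (-lam)) := by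
  have hle (f : E → ℝ) (hf : MemLp f 2 μ) (n : ℕ) :=
    hdecay.eLpNorm_markovOp_pow_le hrev hdense hf n
  exact ⟨hle, WassersteinGap.l2Beta_le fun f hf => by simpa using hle f hf 1⟩

theorem proposition2p2 {E : Type*} [TopologicalSpace E] [PolishSpace E] [MeasurableSpace E]
    [BorelSpace E] (d : E → E → ℝ≥0) (hd : WassersteinGap.IsDistanceLike d)
    (P : Kernel E E) [IsMarkovKernel P] (μ : Measure E) [IsProbabilityMeasure μ]
    (hrev : P.IsReversible μ)
    (hdense : Dense {g : Lp ℝ 2 μ | ∃ f : E → ℝ, WassersteinGap.IsLipBounded d μ f ∧ g =ᵐ[μ] f})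
    (lam : ℝ) (hlam : 0 < lam)
    (hdecay : ∀ f : E → ℝ, WassersteinGap.IsLipBounded d μ f → (∀ x, 0 ≤ f x) → ∫ x, f x ∂μ = 1 →
      WassersteinGap.wasserstein d (WassersteinGap.densityMeasure f μ) μ < ∞ ∧
      ∃ C : ℝ≥0, ∀ n : ℕ,
        WassersteinGap.wasserstein d
            (WassersteinGap.densityMeasure (WassersteinGap.markovOp (P ^ n) f) μ) μ ≤
          C * ENNReal.ofReal (Real.exp (-lam * n)) *
            WassersteinGap.wasserstein d (WassersteinGap.densityMeasure f μ) μ) :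
    (∀ f : E → ℝ, MemLp f 2 μ → ∀ n : ℕ,
      eLpNorm (fun x => WassersteinGap.markovOp (P ^ n) f x - ∫ y, f y ∂μ) 2 μ ^ 2 ≤
        eLpNorm (fun x => f x - ∫ y, f y ∂μ) 2 μ ^ 2 * ENNReal.ofReal (Real.exp (-lam * n))) ∧
    WassersteinGap.HasL2SpectralGap P μ := by
  have hgap := proposition2p2_general hrev hdense hdecay
  exact ⟨fun f hf n => WassersteinGap.sq_le_sq_mul_of_le_mul (hgap.1 f hf n)
    (by simp [mul_nonneg, hlam.le]), hgap.2.trans_lt (by simpa using hlam)⟩
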